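/- Let $c\in\mathbb{C}\setminus\{0\}$ and set $g(u,v)=\frac{c}{u-v}$, $f(u,v)=1+g(u,v)$, $h(u,v)=\frac{u-v+c}{c}$. Let $V$ be a complex vector space with basis $e_i$ of parities $[i]\in\mathbb{Z}/2$, and let $R(u,v)=\mathbb{I}+g(u,v)P$, where $P(e_k\otimes e_l)=(-1)^{[k][l]}e_l\otimes e_k$. A model consists of a $\mathbb{Z}/2$-graded complex vector space $H$, operators $T_{ij}(u)$ on $H$ of parity $[i]+[j]$ (for $u$ in some set of spectral parameters) satisfying, for $u\neq v$, the graded relation $$R(u,v)\,(T(u)\otimes\mathbb{I})\,(\mathbb{I}\otimes T(v))=(\mathbb{I}\otimes T(v))\,(T(u)\otimes\mathbb{I})\,R(u,v)\quad\text{on } V\otimes V\otimes H$$ (all tensor products are graded), a vector $|0\rangle\in H$ and a linear functional $\langle 0|$ on $H$ with $\langle0|0\rangle=1$, $T_{ii}(u)|0\rangle=\lambda_i(u)|0\rangle$, $\langle0|T_{ii}(u)=\lambda_i(u)\langle0|$ for some scalar functions $\lambda_i$, $T_{ij}(u)|0\rangle=0$ for $i>j$, and $\langle0|T_{ij}(u)=0$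 for $i<j$. It is $\mathfrak{gl}(2|1)$-based if $i\in\{1,2,3\}$ with $[1]=[2]=0$, $[3]=1$, and $\mathfrak{gl}(1|1)$-based if $i\in\{2,3\}$ with $[2]=0$, $[3]=1$. Put $r_3(u)=\lambda_3(u)/\lambda_2(u)$. For $\bar v=(v_1,\dots,v_b)$, $b\ge0$, the Bethe vector and the dual Bethe vector of a $\mathfrak{gl}(1|1)$-based model are $$\mathbb{B}_{0,b}(\bar v)=\frac{T_{23}(v_1)\cdots T_{23}(v_b)|0\rangle}{\prod_k\lambda_2(v_k)\prod_{\ell>m}h(v_\ell,v_m)},\qquad \mathbb{C}_{0,b}(\bar v)=(-1)^{\frac{b^2-b}{2}}\frac{\langle0|T_{32}(v_1)\cdots T_{32}(v_b)}{\prod_k\lambda_2(v_k)\prod_{\ell>m}h(v_m,v_\ell)};$$ in a $\mathfrak{gl}(2|1)$-based model the same formulas give the general Bethe vectors $\mathbb{B}_{a,b}(\bar u;\bar v)$ and $\mathbb{C}_{a,b}(\bar u;\bar v)$ in the case $a=0$, $\bar u=\emptyset$. Let $S_{0,b}=\mathbb{C}_{0,b}(\bar v^C)\,\mathbb{B}_{0,b}(\bar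 v^B)$. Let $\bar v^C=(v^C_1,\dots,v^C_b)$ and $\bar v^B=(v^B_1,\dots,v^B_b)$ be generic: the $2b$ spectral parameters are pairwise distinct, $\lambda_2$ does not vanish at them, and $h(v^B_\ell,v^B_m)\ne0$, $h(v^C_m,v^C_\ell)\neq0$ for $\ell>m$ (so that all expressions are defined). No other condition (in particular no Bethe equation) is imposed. Then, for every $\mathfrak{gl}(1|1)$-based model and for every $\mathfrak{gl}(2|1)$-based model, $$S_{0,b}=\Delta'_b(\bar v^C)\,\Delta_b(\bar v^B)\,\det_{1\le j,k\le b}\Bigl[g(v^C_j,v^B_k)\bigl(r_3(v^B_k)-r_3(v^C_j)\bigr)\Bigr],$$ where $\Delta'_b(\bar x)=\prod_{j<k}g(x_j,x_k)$ and $\Delta_b(\bar x)=\prod_{j>k}g(x_j,x_k)$. -/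

import Mathlib

namespace BetheGL

/-! ### Rational functions and products over sets of variables -/

/-- `g(u,v) = c / (u - v)`. -/
noncomputable def g (c u v : ℂ) : ℂ := c / (u - v)

/-- `f(u,v) = 1 + g(u,v)`. -/
noncomputable def f (c u v : ℂ) : ℂ := 1 + g c u v

/-- `h(u,v) = f(u,v) / g(u,v) = (u - v + c) / c`. -/
noncomputable def h (c u v : ℂ) : ℂ := (u - v + c) / c

/-- The product of `F (x j) (y k)` over all pairs. -/
noncomputable def prodPairs (F : ℂ → ℂ → ℂ) {m n : ℕ} (x : Fin m → ℂ) (y : Fin n → ℂ) : ℂ :=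
  ∏ j, ∏ k, F (x j) (y k)

/-- `Δ'(x) = ∏_{j<k} g(x_j, x_k)`. -/
noncomputable def Delta' (c : ℂ) {n : ℕ} (x : Fin n → ℂ) : ℂ :=
  ∏ j, ∏ k ∈ Finset.univ.filter (fun k => j < k), g c (x j) (x k)

/-- `Δ(x) = ∏_{j>k} g(x_j, x_k)`. -/
noncomputable def Delta (c : ℂ) {n : ℕ} (x : Fin n → ℂ) : ℂ :=
  ∏ j, ∏ k ∈ Finset.univ.filter (fun k => k < j), g c (x j) (x k)

/-- The partition function of the six-vertex model with domain wall boundary conditions,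
`K_n(x|y) = Δ'(x) Δ(y) h(x,y) det (g(x_j,y_k) / h(x_j,y_k))`. -/
noncomputable def K (c : ℂ) {n : ℕ} (x y : Fin n → ℂ) : ℂ :=
  Delta' c x * Delta c y * prodPairs (h c) x y *
    Matrix.det (Matrix.of fun j k => g c (x j) (y k) / h c (x j) (y k))

/-- The subset of the variables `x` with labels in `s`, in its natural order. -/
noncomputable def sub {n : ℕ} (x : Fin n → ℂ) (s : Finset (Fin n)) {m : ℕ} (hs : s.card = m) :
    Fin m → ℂ :=
  fun k => x (s.orderEmbOfFin hs k)

/-! ### The graded `RTT`-relation -/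

/-- The sign `(-1)^{p q}` of exchanging homogeneous elements of parities `p` and `q`. -/
def koszul (p q : ZMod 2) : ℂ := if p * q = 0 then 1 else -1

section RTT

variable {N : ℕ} (par : Fin N → ZMod 2) {H : Type*} [AddCommGroup H] [Module ℂ H]

/- Operators on `V ⊗ V ⊗ H`, where `V = ℂ^N` has a basis `e_i` of parities `par i`, are written as
matrices with entries in `End H`: the entry at `((i, j), (k, l))` is the coefficient that
sends `e_k ⊗ e_l ⊗ x` to `e_i ⊗ e_j ⊗ H`. -/

/-- The graded permutation `P (e_k ⊗ e_l ⊗ x) = (-1)^{[k][l]} e_l ⊗ e_k ⊗ x`. -/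
noncomputable def gradedPerm : Matrix (Fin N × Fin N) (Fin N × Fin N) (Module.End ℂ H) :=
  Matrix.of fun a b =>
    if a.1 = b.2 ∧ a.2 = b.1 then koszul (par b.1) (par b.2) • 1 else 0

/-- `R(u,v) = I + g(u,v) P`. -/
noncomputable def RMatrix (c u v : ℂ) :
    Matrix (Fin N × Fin N) (Fin N × Fin N) (Module.End ℂ H) :=
  1 + g c u v • gradedPerm par

/-- `A ⊗ I = ∑ e_{ij} ⊗ 1 ⊗ A_{ij}` with `[A_{ij}] = [i] + [j]`, acting by
`(A ⊗ I) (e_k ⊗ e_l ⊗ x) = ∑_i (-1)^{([i]+[k])([k]+[l])} e_i ⊗ e_l ⊗ A_{ik} x`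
(the operator `A_{ik}` passes `e_k ⊗ e_l`). -/
noncomputable def inFirst (A : Matrix (Fin N) (Fin N) (Module.End ℂ H)) :
    Matrix (Fin N × Fin N) (Fin N × Fin N) (Module.End ℂ H) :=
  Matrix.of fun a b =>
    if a.2 = b.2 then koszul (par a.1 + par b.1) (par b.1 + par b.2) • A a.1 b.1 else 0

/-- `I ⊗ A = ∑ 1 ⊗ e_{ij} ⊗ A_{ij}` with `[A_{ij}] = [i] + [j]`, acting by
`(I ⊗ A) (e_k ⊗ e_l ⊗ x) = ∑_j (-1)^{([j]+[l])[k]} (-1)^{([j]+[l])([k]+[l])} e_k ⊗ e_j ⊗ A_{jl} x`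
(the unit `e_{jl}` passes `e_k`, and the operator `A_{jl}` passes `e_k ⊗ e_l`). -/
noncomputable def inSecond (A : Matrix (Fin N) (Fin N) (Module.End ℂ H)) :
    Matrix (Fin N × Fin N) (Fin N × Fin N) (Module.End ℂ H) :=
  Matrix.of fun a b =>
    if a.1 = b.1 then
      (koszul (par a.2 + par b.2) (par b.1) *
        koszul (par a.2 + par b.2) (par b.1 + par b.2)) • A a.2 b.2
    else 0

end RTT

/-- The parities of `ℂ^{2|1}`: `[1] = [2] = 0`, `[3] = 1`. The labels `1, 2, 3` are the elements
`0, 1, 2` of `Fin 3`. -/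
def par21 : Fin 3 → ZMod 2 := ![0, 0, 1]

/-- The parities of `ℂ^{1|1}`. The labels `2, 3` (with `[2] = 0`, `[3] = 1`) of the
`gl(1|1)` sector of a `gl(2|1)`-based model are the elements `0, 1` of `Fin 2`. -/
def par11 : Fin 2 → ZMod 2 := ![0, 1]

/-- A quantum integrable (generalized) model with the rational `R`-matrix of parities `par` and
constant `c`, acting in the `ℤ/2`-graded complex vector space `H`: a graded monodromy matrix
satisfying the `RTT`-relation, a pseudovacuum vector and a dual pseudovacuum vector. -/
structure Model {N : ℕ} (par : Fin N → ZMod 2) (c : ℂ)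
    (H : Type*) [AddCommGroup H] [Module ℂ H] where
  /-- The values of the spectral parameter at which the monodromy matrix is defined. -/
  dom : Set ℂ
  /-- The even and the odd part of `H`. -/
  grade : ZMod 2 → Submodule ℂ H
  isInternal : DirectSum.IsInternal grade
  /-- The monodromy matrix. -/
  T : ℂ → Matrix (Fin N) (Fin N) (Module.End ℂ H)
  T_mem : ∀ u ∈ dom, ∀ i j p, ∀ x ∈ grade p, T u i j x ∈ grade (par i + par j + p)
  rtt : ∀ u ∈ dom, ∀ v ∈ dom, u ≠ v →
    RMatrix par c u v * inFirst par (T u) * inSecond par (T v) =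
      inSecond par (T v) * inFirst par (T u) * RMatrix par c u v
  /-- The pseudovacuum vector `|0⟩`. -/
  vac : H
  /-- The dual pseudovacuum vector `⟨0|`. -/
  dualVac : Module.Dual ℂ H
  /-- The vacuum eigenvalues `λ_i(u)`. -/
  lam : Fin N → ℂ → ℂ
  T_diag_vac : ∀ u ∈ dom, ∀ i, T u i i vac = lam i u • vac
  dualVac_T_diag : ∀ u ∈ dom, ∀ i, dualVac ∘ₗ T u i i = lam i u • dualVac
  T_lower_vac : ∀ u ∈ dom, ∀ i j, j < i → T u i j vac = 0
  dualVac_T_upper : ∀ u ∈ dom, ∀ i j, i < j → dualVac ∘ₗ T u i j = 0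
  dualVac_vac : dualVac vac = 1

namespace Model

section General

variable {N : ℕ} {par : Fin N → ZMod 2} {c : ℂ} {H : Type*} [AddCommGroup H] [Module ℂ H]
  (M : Model par c H)

/-- The ordered product `T_{ij}(v_1) ⋯ T_{ij}(v_n)`. -/
noncomputable def TProd (i j : Fin N) {n : ℕ} (v : Fin n → ℂ) : Module.End ℂ H :=
  (List.ofFn fun k => M.T (v k) i j).prod

/-- For an odd creation operator `T_{ij}`:
`T_{ij}(v_1) ⋯ T_{ij}(v_n) / ∏_{ℓ>m} h(v_ℓ, v_m)`. -/
noncomputable def TUp (i j : Fin N) {n : ℕ} (v : Fin n → ℂ) : Module.End ℂ H :=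
  (∏ l, ∏ m ∈ Finset.univ.filter (fun m => m < l), h c (v l) (v m))⁻¹ • M.TProd i j v

/-- For an odd annihilation operator `T_{ij}`:
`T_{ij}(v_1) ⋯ T_{ij}(v_n) / ∏_{ℓ>m} h(v_m, v_ℓ)`. -/
noncomputable def TDown (i j : Fin N) {n : ℕ} (v : Fin n → ℂ) : Module.End ℂ H :=
  (∏ l, ∏ m ∈ Finset.univ.filter (fun m => m < l), h c (v m) (v l))⁻¹ • M.TProd i j v

/-- `λ_i(v) = ∏_k λ_i(v_k)`. -/
noncomputable def lamProd (i : Fin N) {n : ℕ} (v : Fin n → ℂ) : ℂ := ∏ k, M.lam i (v k)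

end General

section GL21

variable {c : ℂ} {H : Type*} [AddCommGroup H] [Module ℂ H] (M : Model par21 c H)

/-- The coefficient
`K_n(v_I|u_I) f(u_I,u_II) g(v_II,v_I) / (λ_2(v) λ_2(u_II) f(v,u))` that enters the Bethe
vector and the dual Bethe vector, for the partition with `u_I = sub u I`, `v_I = sub v J`. -/
noncomputable def betheCoeff {a b : ℕ} (u : Fin a → ℂ) (v : Fin b → ℂ) {n : ℕ}
    (I : {I : Finset (Fin a) // I.card = n}) (J : {J : Finset (Fin b) // J.card = n}) : ℂ :=
  K c (sub v J.1 J.2) (sub u I.1 I.2) *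
      (prodPairs (f c) (sub u I.1 I.2) (sub u I.1ᶜ rfl) *
        prodPairs (g c) (sub v J.1ᶜ rfl) (sub v J.1 J.2)) /
    (M.lamProd 1 v * M.lamProd 1 (sub u I.1ᶜ rfl) * prodPairs (f c) v u)

/-- The Bethe vector `𝔹_{a,b}(u;v)` of a `gl(2|1)`-based model. -/
noncomputable def bethe {a b : ℕ} (u : Fin a → ℂ) (v : Fin b → ℂ) : H :=
  ∑ n ∈ Finset.range (min a b + 1), ∑ I : {I : Finset (Fin a) // I.card = n},
    ∑ J : {J : Finset (Fin b) // J.card = n},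
      M.betheCoeff u v I J •
        (M.TUp 0 2 (sub v J.1 J.2) * M.TUp 1 2 (sub v J.1ᶜ rfl) *
          M.TProd 0 1 (sub u I.1ᶜ rfl)) M.vac

/-- The dual Bethe vector `ℂ_{a,b}(u;v)` of a `gl(2|1)`-based model. -/
noncomputable def dualBethe {a b : ℕ} (u : Fin a → ℂ) (v : Fin b → ℂ) : Module.Dual ℂ H :=
  (-1 : ℂ) ^ ((b ^ 2 - b) / 2) •
    ∑ n ∈ Finset.range (min a b + 1), ∑ I : {I : Finset (Fin a) // I.card = n},
      ∑ J : {J : Finset (Fin b) // J.card = n},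
        M.betheCoeff u v I J •
          (M.dualVac ∘ₗ
            (M.TProd 1 0 (sub u I.1ᶜ rfl) * M.TDown 2 1 (sub v J.1ᶜ rfl) *
              M.TDown 2 0 (sub v J.1 J.2)))

/-- The scalar product `S_{a,b}(u^C; v^C | u^B; v^B) = ℂ_{a,b}(u^C; v^C) 𝔹_{a,b}(u^B; v^B)`. -/
noncomputable def scalarProduct {a b : ℕ} (uC : Fin a → ℂ) (vC : Fin b → ℂ)
    (uB : Fin a → ℂ) (vB : Fin b → ℂ) : ℂ :=
  M.dualBethe uC vC (M.bethe uB vB)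

end GL21

section GL11

variable {c : ℂ} {H : Type*} [AddCommGroup H] [Module ℂ H] (M : Model par11 c H)

/-- The Bethe vector `𝕋_{23}(v)|0⟩ / λ_2(v)` of a `gl(1|1)`-based model. -/
noncomputable def bethe11 {b : ℕ} (v : Fin b → ℂ) : H :=
  (M.lamProd 0 v)⁻¹ • M.TUp 0 1 v M.vac

/-- The dual Bethe vector `(-1)^{(b²-b)/2} ⟨0|𝕋_{32}(v) / λ_2(v)` of a `gl(1|1)`-based model. -/
noncomputable def dualBethe11 {b : ℕ} (v : Fin b → ℂ) : Module.Dual ℂ H :=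
  (-1 : ℂ) ^ ((b ^ 2 - b) / 2) • (M.lamProd 0 v)⁻¹ • (M.dualVac ∘ₗ M.TDown 1 0 v)

/-- The scalar product of Bethe vectors of a `gl(1|1)`-based model. -/
noncomputable def scalarProduct11 {b : ℕ} (vC vB : Fin b → ℂ) : ℂ :=
  M.dualBethe11 vC (M.bethe11 vB)

end GL11

end Model

/-- `Δ'_b(v^C) Δ_b(v^B) det [g(v^C_j, v^B_k) (r(v^B_k) - r(v^C_j))]`. -/
noncomputable def detFormula (c : ℂ) (r : ℂ → ℂ) {b : ℕ} (vC vB : Fin b → ℂ) : ℂ :=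
  Delta' c vC * Delta c vB *
    Matrix.det (Matrix.of fun j k => g c (vC j) (vB k) * (r (vB k) - r (vC j)))

end BetheGL

/-! The R-matrix only permutes the two auxiliary indices. So the entries A, B, C, D of the monodromy
matrix with indices in one pair (even, odd) have closed exchange relations in any model, and the
gl(1|1) and gl(2|1) claims are one claim about `Sector11`.

Owing to the grading, A and D pass B with the same factor f. Hence D(u) - r(u)A(u) produces only
unwanted terms on B(y)|0⟩, and C(l)B(y)|0⟩ takes the form A(l)v, where v is a sum of products with
one B removed, weighted by g(l,y_k)(r(y_k) - r(l)) (`C_opProd_vac`). This is the pattern of a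
Laplace expansion: by induction ⟨0|C(z)v is, up to a prefactor, the determinant with rows z and a
last row l.

It remains to move A(l) to the left through the other C's (`dualVac_opProd_A`). The wanted term
gives the eigenvalue and factors f. Each unwanted term is a multiple of ⟨0|C(z) with l among the z,
so its determinant has two equal rows and vanishes; the coefficients of these terms are never
needed.

Reordering the B's would divide by values of f that may vanish. The weights `pairWeight`, `fUp`,
`fDown` keep everything free of division by f, and f = gh finally splits them into Δ, Δ' and the
normalization by h. -/

namespace BetheGL

/-! ### The exchange algebra of one even and one odd index, and its weights -/

section Sector

variable {H : Type*} [AddCommGroup H] [Module ℂ H]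

/-- The exchange relations of the entries `A = T_{22}`, `B = T_{23}`, `C = T_{32}`, `D = T_{33}`
of a monodromy matrix with parities `[2] = 0`, `[3] = 1`, together with their action on the
pseudovacuum vectors. -/
structure Sector11 (c : ℂ) (dom : Set ℂ) (A B C D : ℂ → Module.End ℂ H) (vac : H)
    (dualVac : Module.Dual ℂ H) (lam r : ℂ → ℂ) : Prop where
  AA : ∀ u ∈ dom, ∀ v ∈ dom, u ≠ v → A u * A v = A v * A u
  BB : ∀ u ∈ dom, ∀ v ∈ dom, u ≠ v → f c u v • (B u * B v) = -(f c v u • (B v * B u))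
  AB : ∀ u ∈ dom, ∀ v ∈ dom, u ≠ v →
    A u * B v = f c v u • (B v * A u) + g c u v • (B u * A v)
  DB : ∀ u ∈ dom, ∀ v ∈ dom, u ≠ v →
    D u * B v = f c v u • (B v * D u) + g c u v • (B u * D v)
  CB : ∀ u ∈ dom, ∀ v ∈ dom, u ≠ v →
    C u * B v = -(B v * C u) + g c u v • (A u * D v - A v * D u)
  CA : ∀ u ∈ dom, ∀ v ∈ dom, u ≠ v →
    C u * A v = f c u v • (A v * C u) - g c u v • (A u * C v)
  A_vac : ∀ u ∈ dom, A u vac = lam u • vac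
  D_vac : ∀ u ∈ dom, D u vac = (r u * lam u) • vac
  C_vac : ∀ u ∈ dom, C u vac = 0
  dualVac_A : ∀ u ∈ dom, dualVac ∘ₗ A u = lam u • dualVac
  dualVac_vac : dualVac vac = 1

/-- The ordered product `X(y_1) ⋯ X(y_n)`. -/
noncomputable def opProd (X : ℂ → Module.End ℂ H) {n : ℕ} (y : Fin n → ℂ) : Module.End ℂ H :=
  (List.ofFn fun k => X (y k)).prod

theorem opProd_zero (X : ℂ → Module.End ℂ H) (y : Fin 0 → ℂ) : opProd X y = 1 := by
  simp [opProd]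

theorem opProd_succ (X : ℂ → Module.End ℂ H) {n : ℕ} (y : Fin (n + 1) → ℂ) :
    opProd X y = X (y 0) * opProd X (fun i => y i.succ) := by
  simp [opProd, List.ofFn_succ]

theorem opProd_castSucc (X : ℂ → Module.End ℂ H) {n : ℕ} (y : Fin (n + 1) → ℂ) :
    opProd X y = opProd X (fun i => y i.castSucc) * X (y (Fin.last n)) := by
  rw [opProd, List.ofFn_succ', List.concat_eq_append, List.prod_append, List.prod_singleton]
  rfl

/-- The product of `f` over the pairs of variables that contain `y_k`. -/
noncomputable def pairWeight (c : ℂ) {n : ℕ} (y : Fin (n + 1) → ℂ) (k : Fin (n + 1)) : ℂ :=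
  ∏ i : Fin n, if i.castSucc < k then f c (y k) (y (k.succAbove i))
    else f c (y (k.succAbove i)) (y k)

theorem pairWeight_zero (c : ℂ) {n : ℕ} (y : Fin (n + 1) → ℂ) :
    pairWeight c y 0 = ∏ i : Fin n, f c (y i.succ) (y 0) := by
  simp [pairWeight]

theorem pairWeight_succ (c : ℂ) {n : ℕ} (y : Fin (n + 2) → ℂ) (k : Fin (n + 1)) :
    pairWeight c y k.succ = f c (y k.succ) (y 0) * pairWeight c (fun i => y i.succ) k := by
  simp [pairWeight, Fin.prod_univ_succ (n := n), Fin.castSucc_lt_iff_succ_le]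

/-- `∏_{ℓ>m} f(y_ℓ, y_m)`. -/
noncomputable def fUp (c : ℂ) {n : ℕ} (y : Fin n → ℂ) : ℂ :=
  ∏ l, ∏ m ∈ Finset.univ.filter (fun m => m < l), f c (y l) (y m)

/-- `∏_{ℓ>m} f(y_m, y_ℓ)`. -/
noncomputable def fDown (c : ℂ) {n : ℕ} (y : Fin n → ℂ) : ℂ :=
  ∏ l, ∏ m ∈ Finset.univ.filter (fun m => m < l), f c (y m) (y l)

theorem fUp_succ (c : ℂ) {n : ℕ} (y : Fin (n + 1) → ℂ) :
    fUp c y = (∏ i : Fin n, f c (y i.succ) (y 0)) * fUp c (fun i => y i.succ) := by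
  simp [fUp, Finset.prod_filter, Fin.prod_univ_succ (n := n), Finset.prod_mul_distrib]

theorem fDown_castSucc (c : ℂ) {n : ℕ} (y : Fin (n + 1) → ℂ) :
    fDown c y = fDown c (fun i => y i.castSucc) *
      ∏ i : Fin n, f c (y i.castSucc) (y (Fin.last n)) := by
  have : ∀ i : Fin n, ¬ (Fin.last n < i.castSucc) := fun i => (Fin.castSucc_lt_last i).le.not_gt
  simp [fDown, Finset.prod_filter, Fin.prod_univ_castSucc (n := n), Fin.castSucc_lt_last, this]

/-- Makes the weight a common factor of the Laplace expansion: the coefficient of the term without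
y_k times the inductive prefactor does not depend on k. -/
theorem fUp_eq_pairWeight_mul (c : ℂ) {n : ℕ} (y : Fin (n + 1) → ℂ) (k : Fin (n + 1)) :
    fUp c y = pairWeight c y k * fUp c (fun i => y (k.succAbove i)) := by
  induction n with
  | zero =>
    obtain rfl : k = 0 := Subsingleton.elim (α := Fin 1) k 0
    simp [fUp, pairWeight]
  | succ n ih =>
    refine Fin.cases ?_ (fun k => ?_) k
    · rw [fUp_succ, pairWeight_zero]; simp
    · rw [fUp_succ, pairWeight_succ, ih _ k, fUp_succ c (fun i => y (k.succ.succAbove i)),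
        Fin.prod_univ_succAbove _ k]
      simp only [Fin.succ_succAbove_zero, Fin.succ_succAbove_succ]
      ring

/-- Partial fractions, from (x - y) + (y - z) = x - z. Every recombination of unwanted terms below
reduces to it. -/
theorem g_mul_g (c : ℂ) {x y z : ℂ} (hxy : x ≠ y) (hyz : y ≠ z) (hxz : x ≠ z) :
    g c x y * g c y z = g c x z * (g c x y + g c y z) := by
  have h1 := sub_ne_zero.2 hxy
  have h2 := sub_ne_zero.2 hyz
  have h3 := sub_ne_zero.2 hxz
  simp only [g]
  field_simp
  ring

theorem g_swap (c x y : ℂ) : g c y x = -g c x y := by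
  simp only [g]
  rw [← neg_sub x y, div_neg]

theorem f_swap (c x y : ℂ) : f c y x = 1 - g c x y := by
  rw [f, g_swap, sub_eq_add_neg]

/-! ### Action of the entries on products of creation operators -/

variable {c : ℂ} {dom : Set ℂ} {A B C D : ℂ → Module.End ℂ H} {vac : H}
  {dualVac : Module.Dual ℂ H} {lam r : ℂ → ℂ}

/-- The action of a diagonal entry on a product of creation operators. -/
theorem diag_opProd_vac {T : ℂ → Module.End ℂ H} {t : ℂ → ℂ}
    (BB : ∀ u ∈ dom, ∀ v ∈ dom, u ≠ v → f c u v • (B u * B v) = -(f c v u • (B v * B u)))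
    (TB : ∀ u ∈ dom, ∀ v ∈ dom, u ≠ v →
      T u * B v = f c v u • (B v * T u) + g c u v • (B u * T v))
    (T_vac : ∀ u ∈ dom, T u vac = t u • vac)
    {n : ℕ} (y : Fin (n + 1) → ℂ) (hy : ∀ k, y k ∈ dom) (hinj : Function.Injective y)
    {u : ℂ} (hu : u ∈ dom) (huy : ∀ k, u ≠ y k) :
    T u (opProd B y vac) = (t u * ∏ i, f c (y i) u) • opProd B y vac +
      ∑ k : Fin (n + 1), ((-1) ^ (k : ℕ) * pairWeight c y k * (g c u (y k) * t (y k))) •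
        B u (opProd B (fun i => y (k.succAbove i)) vac) := by
  induction n generalizing u with
  | zero =>
    have h1 := LinearMap.congr_fun (TB u hu (y 0) (hy 0) (huy 0)) vac
    simp only [Module.End.mul_apply, LinearMap.add_apply, LinearMap.smul_apply, T_vac u hu,
      T_vac _ (hy 0), map_smul] at h1
    simp only [opProd_succ, opProd_zero, mul_one, h1]
    simp only [smul_smul, Fin.prod_univ_succ, Fin.sum_univ_succ]
    simp [mul_comm, pairWeight]
  | succ n ih =>
    have hne : ∀ k : Fin (n + 1), y 0 ≠ y k.succ := fun k h => Fin.succ_ne_zero k (hinj h).symm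
    have hinj' : Function.Injective (fun i : Fin (n + 1) => y i.succ) :=
      hinj.comp (Fin.succ_injective _)
    have h0 := LinearMap.congr_fun (TB u hu (y 0) (hy 0) (huy 0))
      (opProd B (fun i => y i.succ) vac)
    have ih1 := ih (fun i => y i.succ) (fun k => hy _) hinj' hu (fun k => huy _)
    have ih2 := ih (fun i => y i.succ) (fun k => hy _) hinj' (hy 0) hne
    simp only [Module.End.mul_apply, LinearMap.add_apply, LinearMap.smul_apply, ih1, ih2] at h0
    rw [opProd_succ, Module.End.mul_apply, h0, Fin.sum_univ_succ (n := n + 1)]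
    simp only [map_add, map_sum, map_smul, opProd_succ B (fun i => y (Fin.succAbove _ i)),
      smul_add, Finset.smul_sum, smul_smul, Fin.succ_succAbove_zero, Fin.succ_succAbove_succ,
      Module.End.mul_apply, pairWeight_zero, pairWeight_succ, Fin.succAbove_zero,
      Fin.prod_univ_succ (n := n + 1)]
    -- The term that trades y_{k+1} for u arises in two ways: T(u) passes B(y_0) first, or it is
    -- exchanged to T(y_0) first. Once `BB` has reordered the former, `g_mul_g` merges both, leaving
    -- exactly the sign and the factor by which the weight grows.
    have key : ∀ k : Fin (n + 1), ∀ w : H, ∀ s : ℂ,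
        (f c (y 0) u * (s * (g c u (y k.succ) * t (y k.succ)))) • B (y 0) (B u w) +
          (g c u (y 0) * (s * (g c (y 0) (y k.succ) * t (y k.succ)))) • B u (B (y 0) w) =
        (-(s * f c (y k.succ) (y 0) * (g c u (y k.succ) * t (y k.succ)))) •
          B u (B (y 0) w) := by
      intro k w s
      have hBB := LinearMap.congr_fun (BB (y 0) (hy 0) u hu (huy 0).symm) w
      simp only [Module.End.mul_apply, LinearMap.smul_apply, LinearMap.neg_apply] at hBB
      rw [mul_comm (f c (y 0) u), mul_smul, hBB, smul_neg, smul_smul, ← neg_smul, ← add_smul]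
      congr 1
      have := g_mul_g c (huy 0) (hne k) (huy k.succ)
      rw [f_swap c (y 0) (y k.succ), f]
      linear_combination s * t (y k.succ) * this
    have hsum := Finset.sum_congr (rfl : (Finset.univ : Finset (Fin (n + 1))) = _)
      (fun k _ => key k (opProd B (fun i => y (k.succAbove i).succ) vac)
        ((-1) ^ (k : ℕ) * pairWeight c (fun i => y i.succ) k))
    rw [Finset.sum_add_distrib] at hsum
    simp only [Fin.val_succ, pow_succ, Fin.val_zero, pow_zero, one_mul]
    have e : ∀ k : Fin (n + 1), (-1 : ℂ) ^ (k : ℕ) * -1 *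
        (f c (y k.succ) (y 0) * pairWeight c (fun i => y i.succ) k) *
        (g c u (y k.succ) * t (y k.succ)) = -((-1) ^ (k : ℕ) *
        pairWeight c (fun i => y i.succ) k * f c (y k.succ) (y 0) *
        (g c u (y k.succ) * t (y k.succ))) := fun k => by ring
    simp only [e]
    rw [← hsum]
    have e1 : f c (y 0) u * (t u * ∏ i : Fin (n + 1), f c (y i.succ) u) =
      t u * (f c (y 0) u * ∏ i : Fin (n + 1), f c (y i.succ) u) := by ring
    have e2 : g c u (y 0) * (t (y 0) * ∏ i : Fin (n + 1), f c (y i.succ) (y 0)) =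
      (∏ i : Fin (n + 1), f c (y i.succ) (y 0)) * (g c u (y 0) * t (y 0)) := by ring
    rw [e1, e2]
    abel

namespace Sector11

variable (S : Sector11 c dom A B C D vac dualVac lam r)
include S

/-- The annihilation operator on a product of creation operators. -/
theorem C_opProd_vac {n : ℕ} (y : Fin (n + 1) → ℂ) (hy : ∀ k, y k ∈ dom)
    (hinj : Function.Injective y) {x : ℂ} (hx : x ∈ dom) (hxy : ∀ k, x ≠ y k) :
    C x (opProd B y vac) =
      ∑ k : Fin (n + 1), ((-1) ^ (k : ℕ) * pairWeight c y k * lam (y k) *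
        (g c x (y k) * (r (y k) - r x))) •
          A x (opProd B (fun i => y (k.succAbove i)) vac) := by
  induction n with
  | zero =>
    have h1 := LinearMap.congr_fun (S.CB x hx (y 0) (hy 0) (hxy 0)) vac
    simp only [Module.End.mul_apply, LinearMap.add_apply, LinearMap.smul_apply, S.C_vac x hx,
      LinearMap.neg_apply, LinearMap.sub_apply, S.D_vac x hx, S.A_vac x hx,
      S.D_vac _ (hy 0), S.A_vac _ (hy 0), map_smul, map_zero, neg_zero, zero_add] at h1
    simp only [opProd_succ, opProd_zero, mul_one, h1]
    simp only [smul_smul, Fin.sum_univ_succ, ← sub_smul]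
    simp [S.A_vac x hx, smul_smul, pairWeight]
    congr 1
    ring
  | succ n ih =>
    have hne : ∀ k : Fin (n + 1), y 0 ≠ y k.succ := fun k h => Fin.succ_ne_zero k (hinj h).symm
    have hinj' : Function.Injective (fun i : Fin (n + 1) => y i.succ) :=
      hinj.comp (Fin.succ_injective _)
    set y' : Fin (n + 1) → ℂ := fun i => y i.succ with hy'
    have h0 := LinearMap.congr_fun (S.CB x hx (y 0) (hy 0) (hxy 0)) (opProd B y' vac)
    have ihC := ih y' (fun k => hy _) hinj' (fun k => hxy _)
    -- A and D have the same product of f in the wanted term, so it cancels in D(u) - r(u)A(u).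
    have diffD : ∀ u ∈ dom, (∀ k : Fin (n + 1), u ≠ y k.succ) →
        D u (opProd B y' vac) = r u • A u (opProd B y' vac) +
          ∑ k : Fin (n + 1), ((-1) ^ (k : ℕ) * pairWeight c y' k * lam (y' k) *
            (g c u (y' k) * (r (y' k) - r u))) •
            B u (opProd B (fun i => y' (k.succAbove i)) vac) := by
      intro u hu huy
      rw [diag_opProd_vac S.BB S.AB S.A_vac y' (fun k => hy _) hinj' hu huy,
        diag_opProd_vac S.BB S.DB S.D_vac y' (fun k => hy _) hinj' hu huy,
        smul_add, smul_smul, add_assoc, Finset.smul_sum, ← Finset.sum_add_distrib]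
      congr 1
      · congr 1; ring
      · refine Finset.sum_congr rfl fun k _ => ?_
        rw [smul_smul, ← add_smul]
        congr 1; ring
    have ihA := diag_opProd_vac S.BB S.AB S.A_vac y' (fun k => hy _) hinj' (hy 0) hne
    have hAA := LinearMap.congr_fun (S.AA x hx (y 0) (hy 0) (hxy 0)) (opProd B y' vac)
    simp only [Module.End.mul_apply] at hAA
    simp only [Module.End.mul_apply, LinearMap.add_apply, LinearMap.smul_apply,
      LinearMap.neg_apply, LinearMap.sub_apply, ihC, diffD _ hx (fun k => hxy _),
      diffD _ (hy 0) hne] at h0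
    rw [opProd_succ, Module.End.mul_apply, h0, Fin.sum_univ_succ (n := n + 1)]
    simp only [map_add, map_smul, ← hAA]
    -- As A(x) and A(y_0) commute, the two D-terms combine with coefficient r(y_0) - r(x). Expanding
    -- A(y_0) then gives the term k = 0 and corrections to the others.
    have e0 : ∀ P Q R' : H, -P + g c x (y 0) • (r (y 0) • A x (A (y 0) (opProd B y' vac)) + Q -
        (r x • A x (A (y 0) (opProd B y' vac)) + R')) =
        (g c x (y 0) * (r (y 0) - r x)) • A x (A (y 0) (opProd B y' vac)) +
        (-P + g c x (y 0) • Q - g c x (y 0) • R') := by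
      intros; module
    rw [e0, ihA]
    simp only [map_add, map_sum, map_smul, opProd_succ B (fun i => y (Fin.succAbove _ i)),
      smul_add, Finset.smul_sum, smul_smul, Fin.succ_succAbove_zero, Fin.succ_succAbove_succ,
      Module.End.mul_apply, pairWeight_zero, pairWeight_succ, Fin.succAbove_zero]
    rw [add_assoc, ← Finset.sum_neg_distrib, ← Finset.sum_add_distrib, ← Finset.sum_sub_distrib,
      ← Finset.sum_add_distrib]
    congr 1
    · congr 1
      simp only [Fin.val_zero, pow_zero, one_mul, hy']
      ring
    · refine Finset.sum_congr rfl fun k _ => ?_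
      change _ = _ • A x (B (y 0) (opProd B (fun i => y' (k.succAbove i)) vac))
      -- For arbitrary w, both sides are combinations of B(y_0)A(x)w and B(x)A(y_0)w; each
      -- coefficient identity is a multiple of `g_mul_g`.
      generalize opProd B (fun i => y' (k.succAbove i)) vac = w
      have h1 := LinearMap.congr_fun (S.AB x hx (y 0) (hy 0) (hxy 0)) w
      have h2 := LinearMap.congr_fun (S.AB (y 0) (hy 0) x hx (hxy 0).symm) w
      simp only [Module.End.mul_apply, LinearMap.add_apply, LinearMap.smul_apply] at h1 h2
      rw [h1, h2]
      have hg := g_mul_g c (hxy 0) (hne k) (hxy k.succ)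
      simp only [← hy', Fin.val_succ, pow_succ, f_swap c x (y 0), g_swap c x (y 0),
        f_swap c (y 0) (y k.succ)]
      change _ = ((-1) ^ (k : ℕ) * -1 * ((1 - g c (y 0) (y k.succ)) * pairWeight c y' k) *
        lam (y' k) * (g c x (y' k) * (r (y' k) - r x))) • _
      change g c x (y 0) * g c (y 0) (y' k) = g c x (y' k) * (g c x (y 0) + g c (y 0) (y' k)) at hg
      change _ = ((-1) ^ (k : ℕ) * -1 * ((1 - g c (y 0) (y' k)) * pairWeight c y' k) *
        lam (y' k) * (g c x (y' k) * (r (y' k) - r x))) • _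
      rw [f]
      generalize (-1 : ℂ) ^ (k : ℕ) = s at *
      generalize pairWeight c y' k = p at *
      generalize y' k = z at *
      generalize g c x (y 0) = a at *
      generalize g c (y 0) z = b at *
      generalize g c x z = d at *
      match_scalars
      · linear_combination (s * p * lam z * (r z - r x) * (1 - a)) * hg
      · linear_combination (s * p * lam z * (r z - r x) * a) * hg

/-- Moving a diagonal entry to the left through a product of annihilation operators. -/
theorem dualVac_opProd_A {n : ℕ} (x : Fin n → ℂ) (hx : ∀ k, x k ∈ dom)
    (hinj : Function.Injective x) {u : ℂ} (hu : u ∈ dom) (hux : ∀ k, x k ≠ u) :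
    dualVac ∘ₗ (opProd C x * A u) - (lam u * ∏ i, f c (x i) u) • dualVac ∘ₗ opProd C x ∈
      Submodule.span ℂ {φ | ∃ z : Fin n → ℂ, Function.Injective z ∧ (∃ j, z j = u) ∧
        (∀ j, z j = u ∨ ∃ i, z j = x i) ∧ φ = dualVac ∘ₗ opProd C z} := by
  induction n generalizing u with
  | zero =>
    simp only [opProd_zero, one_mul, S.dualVac_A u hu, Fin.prod_univ_zero, mul_one]
    have : dualVac ∘ₗ (1 : Module.End ℂ H) = dualVac := rfl
    simp [this]
  | succ n ih =>
    set x' : Fin n → ℂ := fun i => x i.castSucc with hx'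
    set l := x (Fin.last n) with hl
    have hinj' : Function.Injective x' := hinj.comp (Fin.castSucc_injective n)
    have hxl : ∀ k, x' k ≠ l := fun k h => (Fin.castSucc_lt_last k).ne (hinj h)
    have h1 := ih x' (fun k => hx _) hinj' hu (fun k => hux _)
    have h2 := ih x' (fun k => hx _) hinj' (hx (Fin.last n)) hxl
    -- The relation `CA` leaves either A(u) followed by C(l), or A(l) followed by C(u). In both
    -- cases the unwanted terms of the shorter product still contain u after the last C is appended.
    have snoc_mem : ∀ (v w : ℂ), (v = u ∧ w = l) ∨ (v = l ∧ w = u) →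
        ∀ φ ∈ Submodule.span ℂ {φ | ∃ z : Fin n → ℂ, Function.Injective z ∧ (∃ j, z j = v) ∧
          (∀ j, z j = v ∨ ∃ i, z j = x' i) ∧ φ = dualVac ∘ₗ opProd C z},
        φ ∘ₗ C w ∈ Submodule.span ℂ {φ | ∃ z : Fin (n + 1) → ℂ, Function.Injective z ∧
          (∃ j, z j = u) ∧ (∀ j, z j = u ∨ ∃ i, z j = x i) ∧ φ = dualVac ∘ₗ opProd C z} := by
      intro v w hvw φ hφ
      have hwv : w ≠ v := by
        rcases hvw with ⟨rfl, rfl⟩ | ⟨rfl, rfl⟩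
        · exact hux _
        · exact (hux _).symm
      have hw : ∀ i, x' i ≠ w := by
        rcases hvw with ⟨rfl, rfl⟩ | ⟨rfl, rfl⟩
        · exact hxl
        · exact fun i => hux _
      induction hφ using Submodule.span_induction with
      | mem φ h =>
        obtain ⟨z, hz, ⟨j, hj⟩, hzx, rfl⟩ := h
        refine Submodule.subset_span ⟨Fin.snoc z w, ?_, ?_, ?_, ?_⟩
        · refine Fin.snoc_injective_iff.2 ⟨hz, ?_⟩
          rintro ⟨i, hi⟩
          rcases hzx i with h | ⟨i', h⟩
          · exact hwv (hi ▸ h)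
          · exact hw i' (h ▸ hi)
        · rcases hvw with ⟨rfl, rfl⟩ | ⟨rfl, rfl⟩
          · exact ⟨j.castSucc, by simpa using hj⟩
          · exact ⟨Fin.last n, by simp⟩
        · intro i
          refine Fin.lastCases ?_ (fun i => ?_) i
          · rcases hvw with ⟨rfl, rfl⟩ | ⟨rfl, rfl⟩
            · exact Or.inr ⟨Fin.last n, by simp [hl]⟩
            · exact Or.inl (by simp)
          · rcases hzx i with h | ⟨i', h⟩
            · rcases hvw with ⟨rfl, rfl⟩ | ⟨rfl, rfl⟩
              · exact Or.inl (by simpa using h)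
              · exact Or.inr ⟨Fin.last n, by simpa using h⟩
            · exact Or.inr ⟨i'.castSucc, by simpa using h⟩
        · rw [opProd_castSucc]
          simp only [Fin.snoc_castSucc, Fin.snoc_last]
          rfl
      | zero => simp
      | add φ ψ _ _ h1 h2 => rw [LinearMap.add_comp]; exact Submodule.add_mem _ h1 h2
      | smul a φ _ h => rw [LinearMap.smul_comp]; exact Submodule.smul_mem _ _ h
    have m1 := snoc_mem u l (Or.inl ⟨rfl, rfl⟩) _ h1
    have m2 := snoc_mem l u (Or.inr ⟨rfl, rfl⟩) _ h2
    -- The wanted term of the exchanged A(l) is itself unwanted here, since it ends in C(u).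
    have m3 : dualVac ∘ₗ (opProd C x' * C u) ∈ Submodule.span ℂ {φ | ∃ z : Fin (n + 1) → ℂ,
        Function.Injective z ∧ (∃ j, z j = u) ∧ (∀ j, z j = u ∨ ∃ i, z j = x i) ∧
        φ = dualVac ∘ₗ opProd C z} := by
      refine Submodule.subset_span ⟨Fin.snoc x' u, ?_, ⟨Fin.last n, by simp⟩, ?_, ?_⟩
      · refine Fin.snoc_injective_iff.2 ⟨hinj', ?_⟩
        rintro ⟨i, hi⟩
        exact hux _ hi
      · intro i
        refine Fin.lastCases (Or.inl (by simp)) (fun i => Or.inr ⟨i.castSucc, by simp [hx']⟩) i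
      · rw [opProd_castSucc C (Fin.snoc x' u)]
        simp only [Fin.snoc_castSucc, Fin.snoc_last]
    have hCA := S.CA l (hx _) u hu (hux _)
    have m := Submodule.sub_mem _ (Submodule.smul_mem _ (f c l u) m1)
      (Submodule.add_mem _ (Submodule.smul_mem _ (g c l u) m2)
        (Submodule.smul_mem _ (g c l u * (lam l * ∏ i, f c (x' i) l)) m3))
    convert m using 1
    rw [opProd_castSucc, mul_assoc, hCA, Fin.prod_univ_castSucc]
    ext w
    simp only [LinearMap.sub_apply, LinearMap.comp_apply, LinearMap.smul_apply,
      LinearMap.add_apply, Module.End.mul_apply, map_sub, map_smul, smul_eq_mul, ← hl, ← hx']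
    ring

/-- The determinant representation before normalization. -/
theorem dualVac_opProd_opProd_vac {n : ℕ} (x y : Fin n → ℂ) (hx : ∀ k, x k ∈ dom)
    (hy : ∀ k, y k ∈ dom) (hxi : Function.Injective x) (hyi : Function.Injective y)
    (hxy : ∀ j k, x j ≠ y k) :
    dualVac (opProd C x (opProd B y vac)) =
      (-1) ^ n.choose 2 * ((∏ k, lam (x k)) * (∏ k, lam (y k)) * fDown c x * fUp c y) *
        Matrix.det (Matrix.of fun j k => g c (x j) (y k) * (r (y k) - r (x j))) := by
  induction n with
  | zero => simp [opProd_zero, S.dualVac_vac, fDown, fUp]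
  | succ n ih =>
    set x' : Fin n → ℂ := fun i => x i.castSucc with hx'
    set l := x (Fin.last n) with hl
    set v : H := ∑ k : Fin (n + 1), ((-1) ^ (k : ℕ) * pairWeight c y k * lam (y k) *
        (g c l (y k) * (r (y k) - r l))) • opProd B (fun i => y (k.succAbove i)) vac with hv
    have hxl : ∀ k, x' k ≠ l := fun k h => (Fin.castSucc_lt_last k).ne (hxi h)
    have hxi' : Function.Injective x' := hxi.comp (Fin.castSucc_injective n)
    have hS : C l (opProd B y vac) = A l v := by
      rw [S.C_opProd_vac y hy hyi (hx _) (hxy _), hv, map_sum]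
      simp only [map_smul, ← hl]
    -- Needed for all z, not only x', because the unwanted terms of A(l) involve other z, including
    -- l itself. The cofactor sign (-1)^n raises n.choose 2 to (n + 1).choose 2.
    have hz : ∀ z : Fin n → ℂ, Function.Injective z → (∀ j, z j ∈ dom) →
        (∀ j k, z j ≠ y k) → dualVac (opProd C z v) =
          (-1) ^ (n + 1).choose 2 * ((∏ k, lam (z k)) * (∏ k, lam (y k)) * fDown c z * fUp c y) *
          Matrix.det (Matrix.of fun j k => g c ((Fin.snoc z l : Fin (n + 1) → ℂ) j) (y k) *
            (r (y k) - r ((Fin.snoc z l : Fin (n + 1) → ℂ) j))) := by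
      intro z hzi hzd hzy
      rw [Matrix.det_succ_row _ (Fin.last n), hv, map_sum, map_sum, Finset.mul_sum]
      refine Finset.sum_congr rfl fun k _ => ?_
      rw [map_smul, map_smul, ih z (fun i => y (k.succAbove i)) hzd (fun i => hy _) hzi
        (hyi.comp Fin.succAbove_right_injective) (fun j i => hzy _ _), smul_eq_mul,
        fUp_eq_pairWeight_mul c y k, Fin.prod_univ_succAbove (fun k => lam (y k)) k]
      have hM : (Matrix.of fun j k => g c ((Fin.snoc z l : Fin (n + 1) → ℂ) j) (y k) *
            (r (y k) - r ((Fin.snoc z l : Fin (n + 1) → ℂ) j))).submatrix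
            (Fin.last n).succAbove k.succAbove =
          Matrix.of fun j i => g c (z j) (y (k.succAbove i)) *
            (r (y (k.succAbove i)) - r (z j)) := by
        ext j i
        simp
      rw [hM]
      simp only [Matrix.of_apply, Fin.snoc_last, Fin.val_last]
      have hch : (n + 1).choose 2 = n + n.choose 2 := by
        rw [Nat.choose_succ_succ' n 1, Nat.choose_one_right]
      have hs : (-1 : ℂ) ^ n * (-1) ^ n = 1 := by rw [← mul_pow]; simp
      rw [hch, pow_add, pow_add]
      generalize (-1 : ℂ) ^ n = s at *
      linear_combination (-((-1) ^ (k : ℕ) * pairWeight c y k * lam (y k) *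
        (g c l (y k) * (r (y k) - r l)) * ((-1) ^ n.choose 2 * ((∏ k, lam (z k)) *
          (∏ i, lam (y (k.succAbove i))) * fDown c z * fUp c (fun i => y (k.succAbove i))) *
        Matrix.det (Matrix.of fun j i => g c (z j) (y (k.succAbove i)) *
            (r (y (k.succAbove i)) - r (z j)))))) * hs
    -- Some z_j equals l, so row j repeats the last row.
    have hspan : ∀ φ ∈ Submodule.span ℂ {φ | ∃ z : Fin n → ℂ, Function.Injective z ∧
        (∃ j, z j = l) ∧ (∀ j, z j = l ∨ ∃ i, z j = x' i) ∧ φ = dualVac ∘ₗ opProd C z},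
        φ v = 0 := by
      intro φ hφ
      induction hφ using Submodule.span_induction with
      | mem φ h =>
        obtain ⟨z, hzi, ⟨j, hj⟩, hzx, rfl⟩ := h
        have hzx' : ∀ j, ∃ i, z j = x i := fun j => by
          rcases hzx j with h | ⟨i, h⟩
          exacts [⟨_, h⟩, ⟨_, h⟩]
        rw [LinearMap.comp_apply, hz z hzi
          (fun j => by obtain ⟨i, h⟩ := hzx' j; exact h ▸ hx i)
          (fun j k => by obtain ⟨i, h⟩ := hzx' j; exact h ▸ hxy i k),
          Matrix.det_zero_of_row_eq (Fin.castSucc_lt_last j).ne, mul_zero]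
        ext k
        simp [hj]
      | zero => rfl
      | add φ ψ _ _ h1 h2 => rw [LinearMap.add_apply, h1, h2, add_zero]
      | smul a φ _ h => rw [LinearMap.smul_apply, h, smul_zero]
    have hA := hspan _ (S.dualVac_opProd_A x' (fun k => hx _) hxi' (hx (Fin.last n)) hxl)
    have hsnoc : (Fin.snoc x' l : Fin (n + 1) → ℂ) = x := by
      ext i
      refine Fin.lastCases ?_ (fun i => ?_) i <;> simp [hx', hl]
    rw [LinearMap.sub_apply, sub_eq_zero] at hA
    simp only [LinearMap.comp_apply, LinearMap.smul_apply, Module.End.mul_apply] at hA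
    rw [opProd_castSucc, Module.End.mul_apply, ← hl, hS, hA,
      hz x' hxi' (fun _ => hx _) (fun _ _ => hxy _ _), hsnoc, fDown_castSucc,
      Fin.prod_univ_castSucc (fun k => lam (x k)), smul_eq_mul]
    ring

end Sector11

end Sector

end BetheGL
namespace BetheGL

/-! ### Exchange relations from the entries of the graded RTT-relation -/

section RTTEntries

variable {N : ℕ} {par : Fin N → ZMod 2} {c : ℂ} {H : Type*} [AddCommGroup H] [Module ℂ H]

theorem RMatrix_mul_apply (u v : ℂ)
    (X : Matrix (Fin N × Fin N) (Fin N × Fin N) (Module.End ℂ H)) (i j : Fin N)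
    (b : Fin N × Fin N) :
    (RMatrix (H := H) par c u v * X) (i, j) b =
      X (i, j) b + (g c u v * koszul (par j) (par i)) • X (j, i) b := by
  rw [RMatrix, add_mul, one_mul, Matrix.add_apply, smul_mul_assoc, Matrix.smul_apply,
    Matrix.mul_apply, Finset.sum_eq_single (j, i)]
  · simp [gradedPerm, smul_smul]
  · rintro ⟨k, l⟩ - h
    rw [gradedPerm, Matrix.of_apply, if_neg, zero_mul]
    rintro ⟨rfl, rfl⟩
    exact h rfl
  · simp

theorem mul_RMatrix_apply (u v : ℂ)
    (X : Matrix (Fin N × Fin N) (Fin N × Fin N) (Module.End ℂ H)) (a : Fin N × Fin N)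
    (k l : Fin N) :
    (X * RMatrix (H := H) par c u v) a (k, l) =
      X a (k, l) + (g c u v * koszul (par k) (par l)) • X a (l, k) := by
  rw [RMatrix, mul_add, mul_one, Matrix.add_apply, mul_smul_comm, Matrix.smul_apply,
    Matrix.mul_apply, Finset.sum_eq_single (l, k)]
  · simp [gradedPerm, smul_smul]
  · rintro ⟨i, j⟩ - h
    rw [gradedPerm, Matrix.of_apply, if_neg, mul_zero]
    rintro ⟨rfl, rfl⟩
    exact h rfl
  · simp

theorem inFirst_mul_inSecond_apply (X Y : Matrix (Fin N) (Fin N) (Module.End ℂ H))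
    (i j k l : Fin N) :
    (inFirst par X * inSecond par Y) (i, j) (k, l) =
      (koszul (par i + par k) (par k + par j) * (koszul (par j + par l) (par k) *
        koszul (par j + par l) (par k + par l))) • (X i k * Y j l) := by
  rw [Matrix.mul_apply, Finset.sum_eq_single (k, j)]
  · simp [inFirst, inSecond, smul_smul, mul_comm]
  · rintro ⟨k', j'⟩ - h
    by_cases h1 : j = j'
    · by_cases h2 : k' = k
      · exact absurd (by rw [h1, h2]) h
      · simp [inSecond, h2]
    · simp [inFirst, h1]
  · simp

theorem inSecond_mul_inFirst_apply (X Y : Matrix (Fin N) (Fin N) (Module.End ℂ H))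
    (i j k l : Fin N) :
    (inSecond par Y * inFirst par X) (i, j) (k, l) =
      (koszul (par j + par l) (par i) * koszul (par j + par l) (par i + par l) *
        koszul (par i + par k) (par k + par l)) • (Y j l * X i k) := by
  rw [Matrix.mul_apply, Finset.sum_eq_single (i, l)]
  · simp [inFirst, inSecond, smul_smul, mul_comm]
  · rintro ⟨i', l'⟩ - h
    by_cases h1 : i = i'
    · by_cases h2 : l' = l
      · exact absurd (by rw [h1, h2]) h
      · simp [inFirst, h2]
    · simp [inSecond, h1]
  · simp

/-- The entries of the graded `RTT`-relation. -/
theorem Model.rtt_apply (M : Model par c H) {u v : ℂ} (hu : u ∈ M.dom) (hv : v ∈ M.dom)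
    (huv : u ≠ v) (i j k l : Fin N) :
    (koszul (par i + par k) (par k + par j) * (koszul (par j + par l) (par k) *
        koszul (par j + par l) (par k + par l))) • (M.T u i k * M.T v j l) +
      (g c u v * koszul (par j) (par i)) •
        (koszul (par j + par k) (par k + par i) * (koszul (par i + par l) (par k) *
          koszul (par i + par l) (par k + par l))) • (M.T u j k * M.T v i l) =
    (koszul (par j + par l) (par i) * koszul (par j + par l) (par i + par l) *
        koszul (par i + par k) (par k + par l)) • (M.T v j l * M.T u i k) +
      (g c u v * koszul (par k) (par l)) •
        (koszul (par j + par k) (par i) * koszul (par j + par k) (par i + par k) *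
          koszul (par i + par l) (par l + par k)) • (M.T v j k * M.T u i l) := by
  have h := congrFun (congrFun (M.rtt u hu v hv huv) (i, j)) (k, l)
  rwa [mul_assoc, RMatrix_mul_apply, mul_RMatrix_apply, inFirst_mul_inSecond_apply,
    inFirst_mul_inSecond_apply, inSecond_mul_inFirst_apply, inSecond_mul_inFirst_apply] at h

set_option linter.unusedSimpArgs false in
-- An RTT entry with all four indices in {p, q} involves no other entries of T, whatever N is. The
-- domain excludes zeros of λ_p so that r λ_p = λ_q.
theorem Model.sector11 (M : Model par c H) {p q : Fin N} (hp : par p = 0) (hq : par q = 1)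
    (hpq : p < q) :
    Sector11 c {u | u ∈ M.dom ∧ M.lam p u ≠ 0} (fun u => M.T u p p) (fun u => M.T u p q)
      (fun u => M.T u q p) (fun u => M.T u q q) M.vac M.dualVac (M.lam p)
      (fun u => M.lam q u / M.lam p u) := by
  have two : (1 : ZMod 2) + 1 = 0 := rfl
  have k0 : ∀ x, koszul 0 x = 1 := fun x => by simp [koszul]
  have k0' : ∀ x, koszul x 0 = 1 := fun x => by simp [koszul]
  have k1 : koszul 1 1 = -1 := by simp [koszul]
  have hf : ∀ u v, f c u v = 1 + g c u v := fun _ _ => rfl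
  constructor
  · rintro u ⟨hu, -⟩ v ⟨hv, -⟩ huv
    have h1 := M.rtt_apply hu hv huv p p p p
    have h2 := M.rtt_apply hv hu huv.symm p p p p
    simp only [hp, hq, two, add_zero, zero_add, k0, k0', k1, g_swap c u v] at h1 h2
    -- One entry only gives f(u,v)[A(u),A(v)] = 0, and f(u,v) may vanish; since f(u,v) + f(v,u) = 2,
    -- adding the swapped relation avoids the division.
    have h3 : (2 : ℂ) • (M.T u p p * M.T v p p) = (2 : ℂ) • (M.T v p p * M.T u p p) := by
      linear_combination (norm := module) h1 - h2
    exact smul_right_injective _ (two_ne_zero (α := ℂ)) h3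
  · rintro u ⟨hu, -⟩ v ⟨hv, -⟩ huv
    have h1 := M.rtt_apply hu hv huv p p q q
    simp only [hp, hq, two, add_zero, zero_add, k0, k0', k1, g_swap c u v, hf] at h1 ⊢
    linear_combination (norm := module) h1
  · rintro u ⟨hu, -⟩ v ⟨hv, -⟩ huv
    have h1 := M.rtt_apply hv hu huv.symm p p q p
    simp only [hp, hq, two, add_zero, zero_add, k0, k0', k1, g_swap c u v, hf] at h1 ⊢
    linear_combination (norm := module) h1
  · rintro u ⟨hu, -⟩ v ⟨hv, -⟩ huv
    have h1 := M.rtt_apply hu hv huv q p q q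
    simp only [hp, hq, two, add_zero, zero_add, k0, k0', k1, g_swap c u v, hf] at h1 ⊢
    linear_combination (norm := module) -h1
  · rintro u ⟨hu, -⟩ v ⟨hv, -⟩ huv
    have h1 := M.rtt_apply hu hv huv q p p q
    simp only [hp, hq, two, add_zero, zero_add, k0, k0', k1, g_swap c u v, hf] at h1 ⊢
    linear_combination (norm := module) -h1
  · rintro u ⟨hu, -⟩ v ⟨hv, -⟩ huv
    have h1 := M.rtt_apply hu hv huv q p p p
    simp only [hp, hq, two, add_zero, zero_add, k0, k0', k1, g_swap c u v, hf] at h1 ⊢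
    linear_combination (norm := module) h1
  · exact fun u hu => M.T_diag_vac u hu.1 p
  · intro u hu
    rw [M.T_diag_vac u hu.1 q, div_mul_cancel₀ _ hu.2]
  · exact fun u hu => M.T_lower_vac u hu.1 q p hpq
  · exact fun u hu => M.dualVac_T_diag u hu.1 p
  · exact M.dualVac_vac

end RTTEntries

end BetheGL
-- Normalization of the Bethe vectors
namespace BetheGL

theorem f_eq_g_mul_h {c u v : ℂ} (hc : c ≠ 0) (huv : u ≠ v) : f c u v = g c u v * h c u v := by
  have := sub_ne_zero.2 huv
  simp only [f, g, h]
  field_simp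

theorem fUp_eq {c : ℂ} (hc : c ≠ 0) {n : ℕ} (y : Fin n → ℂ) (hy : Function.Injective y) :
    fUp c y = Delta c y * ∏ l, ∏ m ∈ Finset.univ.filter (fun m => m < l), h c (y l) (y m) := by
  simp only [fUp, Delta, ← Finset.prod_mul_distrib]
  refine Finset.prod_congr rfl fun l _ => Finset.prod_congr rfl fun m hm => ?_
  exact f_eq_g_mul_h hc (hy.ne (Finset.mem_filter.1 hm).2.ne')

theorem fDown_eq {c : ℂ} (hc : c ≠ 0) {n : ℕ} (y : Fin n → ℂ) (hy : Function.Injective y) :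
    fDown c y = Delta' c y * ∏ l, ∏ m ∈ Finset.univ.filter (fun m => m < l), h c (y m) (y l) := by
  have e : Delta' c y = ∏ l, ∏ m ∈ Finset.univ.filter (fun m => m < l), g c (y m) (y l) := by
    simp only [Delta', Finset.prod_filter]
    exact Finset.prod_comm
  rw [e, fDown]
  simp only [← Finset.prod_mul_distrib]
  refine Finset.prod_congr rfl fun l _ => Finset.prod_congr rfl fun m hm => ?_
  exact f_eq_g_mul_h hc (hy.ne (Finset.mem_filter.1 hm).2.ne)

/-- The normalized scalar product in the `gl(1|1)` sector of a model. -/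
theorem Model.dualVac_TDown_TUp_vac {N : ℕ} {par : Fin N → ZMod 2} {c : ℂ} (hc : c ≠ 0)
    {H : Type*} [AddCommGroup H] [Module ℂ H] (M : Model par c H) {p q : Fin N}
    (hp : par p = 0) (hq : par q = 1) (hpq : p < q) {b : ℕ} {vC vB : Fin b → ℂ}
    (hC : Function.Injective vC) (hB : Function.Injective vB) (hCB : ∀ j k, vC j ≠ vB k)
    (hhC : ∀ m l, m < l → h c (vC m) (vC l) ≠ 0)
    (hhB : ∀ m l, m < l → h c (vB l) (vB m) ≠ 0)
    (hvC : ∀ k, vC k ∈ M.dom ∧ M.lam p (vC k) ≠ 0)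
    (hvB : ∀ k, vB k ∈ M.dom ∧ M.lam p (vB k) ≠ 0) :
    (-1) ^ ((b ^ 2 - b) / 2) * ((M.lamProd p vC)⁻¹ * ((M.lamProd p vB)⁻¹ *
      M.dualVac (M.TDown q p vC (M.TUp p q vB M.vac)))) =
      detFormula c (fun x => M.lam q x / M.lam p x) vC vB := by
  have key := (M.sector11 hp hq hpq).dualVac_opProd_opProd_vac vC vB hvC hvB hC hB hCB
  change M.dualVac (M.TProd q p vC (M.TProd p q vB M.vac)) = _ at key
  have n1 : M.lamProd p vC ≠ 0 := Finset.prod_ne_zero_iff.2 fun k _ => (hvC k).2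
  have n2 : M.lamProd p vB ≠ 0 := Finset.prod_ne_zero_iff.2 fun k _ => (hvB k).2
  have n3 : ∏ l, ∏ m ∈ Finset.univ.filter (fun m => m < l), h c (vC m) (vC l) ≠ 0 :=
    Finset.prod_ne_zero_iff.2 fun l _ => Finset.prod_ne_zero_iff.2 fun m hm =>
      hhC m l (Finset.mem_filter.1 hm).2
  have n4 : ∏ l, ∏ m ∈ Finset.univ.filter (fun m => m < l), h c (vB l) (vB m) ≠ 0 :=
    Finset.prod_ne_zero_iff.2 fun l _ => Finset.prod_ne_zero_iff.2 fun m hm =>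
      hhB m l (Finset.mem_filter.1 hm).2
  have hb : (b ^ 2 - b) / 2 = b.choose 2 := by
    rw [Nat.choose_two_right, sq, Nat.mul_sub_one]
  -- The sign in the dual Bethe vector cancels the one accumulated by the Laplace expansions.
  have hs : (-1 : ℂ) ^ b.choose 2 * (-1) ^ b.choose 2 = 1 := by rw [← mul_pow]; simp
  rw [fUp_eq hc _ hB, fDown_eq hc _ hC] at key
  simp only [Model.TDown, Model.TUp, LinearMap.smul_apply, map_smul, smul_eq_mul, key, hb,
    detFormula]
  change _ * (_ * (_ * (_ * (_ * (_ * (M.lamProd p vC * M.lamProd p vB * _ * _) * _))))) = _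
  generalize (-1 : ℂ) ^ b.choose 2 = s at *
  field_simp
  rw [sq, hs, one_mul]

theorem sub_univ {b : ℕ} (v : Fin b → ℂ) (hs : (Finset.univ : Finset (Fin b)).card = b) :
    sub v Finset.univ hs = v := by
  have e := Finset.orderEmbOfFin_unique hs (f := id) (fun _ => Finset.mem_univ _) strictMono_id
  exact funext fun k => congrArg v (congrFun e k).symm

/-- The complement of an empty subset equals `univ` only propositionally and its cardinality is not
syntactically b; hence the free length m and the hypothesis `h`. -/
theorem Model.TUp_sub_univ {N : ℕ} {par : Fin N → ZMod 2} {c : ℂ}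
    {H : Type*} [AddCommGroup H] [Module ℂ H] (M : Model par c H) (i j : Fin N)
    {b m : ℕ} (v : Fin b → ℂ) {s : Finset (Fin b)} (hs : s.card = m) (h : s = Finset.univ) :
    M.TUp i j (sub v s hs) = M.TUp i j v := by
  subst h
  obtain rfl : b = m := by simpa using hs
  rw [sub_univ]

theorem Model.TDown_sub_univ {N : ℕ} {par : Fin N → ZMod 2} {c : ℂ}
    {H : Type*} [AddCommGroup H] [Module ℂ H] (M : Model par c H) (i j : Fin N)
    {b m : ℕ} (v : Fin b → ℂ) {s : Finset (Fin b)} (hs : s.card = m) (h : s = Finset.univ) :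
    M.TDown i j (sub v s hs) = M.TDown i j v := by
  subst h
  obtain rfl : b = m := by simpa using hs
  rw [sub_univ]

/-! ### The general gl(2|1) Bethe vectors at a = 0: only the empty partition contributes -/

section GL21

variable {c : ℂ} {H : Type*} [AddCommGroup H] [Module ℂ H] (M : Model par21 c H)

theorem Model.TProd_of_eq_zero (i j : Fin 3) {n : ℕ} (hn : n = 0) (x : Fin n → ℂ) :
    M.TProd i j x = 1 := by
  subst hn
  simp [TProd]

theorem Model.lamProd_of_eq_zero (i : Fin 3) {n : ℕ} (hn : n = 0) (x : Fin n → ℂ) :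
    M.lamProd i x = 1 := by
  subst hn
  simp [lamProd]

theorem Model.betheCoeff_empty {b : ℕ} (v : Fin b → ℂ)
    (I : {I : Finset (Fin 0) // I.card = 0}) (J : {J : Finset (Fin b) // J.card = 0}) :
    M.betheCoeff ![] v I J = (M.lamProd 1 v)⁻¹ := by
  obtain ⟨I, hI⟩ := I
  obtain rfl : I = ∅ := Finset.card_eq_zero.1 hI
  rw [betheCoeff, M.lamProd_of_eq_zero 1 (n := (∅ᶜ : Finset (Fin 0)).card) rfl]
  simp [K, Delta, Delta', prodPairs]

theorem Model.bethe_empty {b : ℕ} (v : Fin b → ℂ) :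
    M.bethe ![] v = (M.lamProd 1 v)⁻¹ • M.TUp 1 2 v M.vac := by
  have e : ∀ J : {J : Finset (Fin b) // J.card = 0}, J.1ᶜ = Finset.univ := fun J => by
    rw [Finset.card_eq_zero.1 J.2, Finset.compl_empty]
  rw [bethe, Nat.zero_min, zero_add, Finset.sum_range_one, Finset.sum_eq_single ⟨∅, rfl⟩,
    Finset.sum_eq_single ⟨∅, rfl⟩, M.betheCoeff_empty, M.TUp_sub_univ 1 2 v rfl (e _),
    M.TProd_of_eq_zero 0 1 (n := (∅ᶜ : Finset (Fin 0)).card) rfl]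
  · simp [TUp, TProd]
  · exact fun J _ hJ => absurd (Subtype.ext (Finset.card_eq_zero.1 J.2)) hJ
  · simp
  · exact fun J _ hJ => absurd (Subtype.ext (Finset.card_eq_zero.1 J.2)) hJ
  · simp

theorem Model.dualBethe_empty {b : ℕ} (v : Fin b → ℂ) :
    M.dualBethe ![] v =
      (-1 : ℂ) ^ ((b ^ 2 - b) / 2) • (M.lamProd 1 v)⁻¹ • (M.dualVac ∘ₗ M.TDown 2 1 v) := by
  have e : ∀ J : {J : Finset (Fin b) // J.card = 0}, J.1ᶜ = Finset.univ := fun J => by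
    rw [Finset.card_eq_zero.1 J.2, Finset.compl_empty]
  rw [dualBethe, Nat.zero_min, zero_add, Finset.sum_range_one, Finset.sum_eq_single ⟨∅, rfl⟩,
    Finset.sum_eq_single ⟨∅, rfl⟩, M.betheCoeff_empty, M.TDown_sub_univ 2 1 v rfl (e _),
    M.TProd_of_eq_zero 1 0 (n := (∅ᶜ : Finset (Fin 0)).card) rfl]
  · simp [TDown, TProd]
  · exact fun J _ hJ => absurd (Subtype.ext (Finset.card_eq_zero.1 J.2)) hJ
  · simp
  · exact fun J _ hJ => absurd (Subtype.ext (Finset.card_eq_zero.1 J.2)) hJ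
  · simp

end GL21

end BetheGL

open BetheGL in
theorem mainTheorem3 (c : ℂ) (hc : c ≠ 0) {H : Type*} [AddCommGroup H] [Module ℂ H]
    (b : ℕ) (vC vB : Fin b → ℂ)
    (hC : Function.Injective vC) (hB : Function.Injective vB) (hCB : ∀ j k, vC j ≠ vB k)
    (hhC : ∀ m l, m < l → h c (vC m) (vC l) ≠ 0)
    (hhB : ∀ m l, m < l → h c (vB l) (vB m) ≠ 0) :
    (∀ M : Model par21 c H,
      (∀ k, vC k ∈ M.dom ∧ M.lam 1 (vC k) ≠ 0) →
      (∀ k, vB k ∈ M.dom ∧ M.lam 1 (vB k) ≠ 0) →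
        M.scalarProduct ![] vC ![] vB =
          detFormula c (fun x => M.lam 2 x / M.lam 1 x) vC vB) ∧
    (∀ M : Model par11 c H,
      (∀ k, vC k ∈ M.dom ∧ M.lam 0 (vC k) ≠ 0) →
      (∀ k, vB k ∈ M.dom ∧ M.lam 0 (vB k) ≠ 0) →
        M.scalarProduct11 vC vB =
          detFormula c (fun x => M.lam 1 x / M.lam 0 x) vC vB) := by
  refine ⟨fun M hvC hvB => ?_, fun M hvC hvB => ?_⟩
  · rw [← M.dualVac_TDown_TUp_vac hc (p := 1) (q := 2) rfl rfl (by decide) hC hB hCB hhC hhB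
      hvC hvB, Model.scalarProduct, M.bethe_empty, M.dualBethe_empty]
    simp [mul_left_comm]
  · rw [← M.dualVac_TDown_TUp_vac hc (p := 0) (q := 1) rfl rfl (by decide) hC hB hCB hhC hhB
      hvC hvB, Model.scalarProduct11, Model.bethe11, Model.dualBethe11]
    simp [mul_left_comm]
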